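/- **Setting.** Let $M$ be a smooth $n$-manifold and $(x^\mu,y^\mu)$ the coordinates of $TM$ induced by a chart; $\partial_\mu=\partial/\partial x^\mu$, $\dot\partial_\mu=\partial/\partial y^\mu$, repeated indices are summed, and all objects are considered at $y\neq0$. An *FP-space* $(M,\lambda_i,F)$ consists of $n$ pointwise linearly independent smooth sections $\lambda_i(x,y)$ of the pullback of $TM$ to $TM\setminus0$, with components $\lambda_i^\alpha$ and inverse matrix $\lambda_{i\mu}$ (so $\lambda_i^\alpha\lambda_{i\beta}=\delta^\alpha_\beta$), positively homogeneous of degree $0$ in $y$, such that for $g_{\mu\nu}=\lambda_{i\mu}\lambda_{i\nu}$ the tensor $\dot\partial_\alpha g_{\mu\nu}$ is totally symmetric, together with $F=\sqrt{g_{\mu\nu}y^\mu y^\nu}$ (with $F=0$ at $y=0$). The Finsler metric is $\tfrac12\dot\partial_\mu\dot\partial_\nu F^2$. Let $\gamma^\alpha_{\mu\nu}$ be the formal Christoffel symbols of the Finsler metric (formed with $\partial_\mu$), $G^\alpha=\tfrac12\gamma^\alpha_{\mu\nu}y^\mu y^\nu$, $N^\alpha_\beta=\dot\partial_\beta G^\alpha$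 (the Barthel connection), $G^\alpha_{\sigma\beta}=\dot\partial_\beta N^\alpha_\sigma$, $\delta_\mu=\partial_\mu-N^\alpha_\mu\dot\partial_\alpha$. Let $\mathring\Gamma^\alpha_{\mu\nu}$, $\mathring C^\alpha_{\mu\nu}$ be the Christoffel symbols formed with $\delta_\mu$, respectively $\dot\partial_\mu$. A Finsler connection has coefficients $(\mathbf F^\alpha_{\mu\nu},\mathbf N^\alpha_\mu,\mathbf C^\alpha_{\mu\nu})$; its $h$-covariant derivative is $X^\alpha_{\mu|\nu}=\delta_\nu X^\alpha_\mu+X^\eta_\mu\mathbf F^\alpha_{\eta\nu}-X^\alpha_\eta\mathbf F^\eta_{\mu\nu}$, and similarly for tensors of any type; its $v$-covariant derivative is obtained by replacing $\delta_\nu,\mathbf F$ by $\dot\partial_\nu,\mathbf C$. The Cartan connection is $(\mathring\Gamma^\alpha_{\mu\nu},N^\alpha_\mu,\mathring C^\alpha_{\mu\nu})$ and the Berwald connection is $(G^\alpha_{\mu\nu},N^\alpha_\mu,0)$. The Miron connection is formed like the Cartan connection, from $g_{\mu\nu}=\lambda_{i\mu}\lambda_{i\nu}$ and the same $N$. With $A^\alpha_{\mu\nu}$,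 $B^\alpha_{\mu\nu}$ denoting $\lambda_i^\alpha$ contracted over $i$ with the $h$-, respectively $v$-covariant derivative of $\lambda_{i\mu}$ in the direction $\nu$ for the Miron connection, the canonical connection is the Miron connection plus $(A,0,B)$; write it $(\Gamma^\alpha_{\mu\nu},N^\alpha_\mu,C^\alpha_{\mu\nu})$. The dual connection is $(\Gamma^\alpha_{\nu\mu},N^\alpha_\mu,C^\alpha_{\nu\mu})$. The FP-space is *FP-Minkowskian* if the $h$- and $hv$-curvature tensors of the Cartan connection vanish, where for a Finsler connection these are $$\mathbf R^\alpha_{\mu\nu\sigma}=\mathfrak U_{(\nu,\sigma)}\{\delta_\sigma\mathbf F^\alpha_{\mu\nu}+\mathbf F^\eta_{\mu\nu}\mathbf F^\alpha_{\eta\sigma}\}+\mathbf C^\alpha_{\mu\eta}(\delta_\sigma\mathbf N^\eta_\nu-\delta_\nu\mathbf N^\eta_\sigma),$$ $$\mathbf P^\alpha_{\mu\nu\sigma}=\dot\partial_\sigma\mathbf F^\alpha_{\mu\nu}-\mathbf C^\alpha_{\mu\sigma|\nu}+\mathbf C^\alpha_{\mu\eta}(\dot\partial_\sigma\mathbf N^\eta_\nu-\mathbf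 F^\eta_{\nu\sigma}),$$ and $\mathfrak U_{(\nu,\sigma)}\{Z_{\nu\sigma}\}=Z_{\nu\sigma}-Z_{\sigma\nu}$. A chart of $M$ gives a *natural coordinate system* if in its induced coordinates $F$ is a function of $y$ only. **Theorem 4.10.** Let $(M,\lambda_i,F)$ be an FP-Minkowskian manifold. In every natural coordinate system, at all $(x,y)$ with $y\ne0$: (a) The Barthel connection $N^\alpha_\beta$ vanishes. (b) The $\delta$-Christoffel symbols $\mathring\Gamma^\alpha_{\mu\nu}$ vanish, both those of the Finsler metric and those of $\lambda_{i\mu}\lambda_{i\nu}$. (c) The Berwald connection vanishes, and the Cartan connection reduces to $(0,0,\mathring C^\alpha_{\mu\nu})$. (d) For components of tensors of any type, the $h$-covariant derivatives with respect to the Cartan and the Berwald connection reduce to partial derivatives: $X^{\cdots}_{\cdots|\nu}=\partial_\nu X^{\cdots}_{\cdots}$. (e) The canonical and the dual connections reduce to $(A^\alpha_{\mu\nu},0,C^\alpha_{\mu\nu})$ and $(A^\alpha_{\nu\mu},0,C^\alpha_{\nu\mu})$, where $C^\alpha_{\mu\nu}=\lambda_i^\alpha\dot\partial_\nu\lambda_{i\mu}$.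 (f) The horizontal coefficients of the canonical and the dual connections have the classical absolute parallelism form, with $y$ as a parameter: they are $\lambda_i^\alpha\partial_\nu\lambda_{i\mu}$ and $\lambda_i^\alpha\partial_\mu\lambda_{i\nu}$. (g) The $h$-covariant derivatives of components of tensors of any type with respect to the canonical and the dual connections have the classical form, with $y$ as a parameter: they are the covariant derivatives, formed with $\partial_\nu$, for the coefficients in (f). -/

import Mathlib

open scoped Manifold ContDiff

namespace FP

noncomputable section

/-! ### Local coordinate calculus on the tangent bundle

In the coordinates `(x, y)` of `TM` induced by a chart of `M`, a function is a map
`x ↦ y ↦ f x y`. The point `x` ranges over the target of the chart and `y` over the nonzero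
vectors. Indices range over `Fin n`. -/

/-- The coordinate space `ℝⁿ`. -/
abbrev Coord (n : ℕ) : Type := EuclideanSpace ℝ (Fin n)

/-- Real functions of the coordinates `(x, y)` of the tangent bundle. -/
abbrev LFun (n : ℕ) : Type := Coord n → Coord n → ℝ

/-- Components `X^{α_1 … α_r}_{μ_1 … μ_s}(x, y)`. -/
abbrev Components (n r s : ℕ) : Type := (Fin r → Fin n) → (Fin s → Fin n) → LFun n

/-- `∂_μ f = ∂f/∂x^μ`. -/
def pd {n : ℕ} (μ : Fin n) (f : LFun n) : LFun n :=
  fun x y => fderiv ℝ (fun x' => f x' y) x (EuclideanSpace.single μ (1 : ℝ))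

/-- `∂̇_μ f = ∂f/∂y^μ`. -/
def vd {n : ℕ} (μ : Fin n) (f : LFun n) : LFun n :=
  fun x y => fderiv ℝ (fun y' => f x y') y (EuclideanSpace.single μ (1 : ℝ))

/-- `δ_μ f = ∂_μ f - N^α_μ ∂̇_α f`; the nonlinear connection is written `N α μ = N^α_μ`. -/
def delta {n : ℕ} (N : Fin n → Fin n → LFun n) (μ : Fin n) (f : LFun n) : LFun n :=
  fun x y => pd μ f x y - ∑ α, N α μ x y * vd α f x y

/-- The Christoffel symbols
`½ g^{αη} (D_μ g_{νη} + D_ν g_{μη} - D_η g_{μν})` of a metric `g` for a system of directional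
derivatives `D_μ`: the formal Christoffel symbols for `D = ∂`, the `δ`-Christoffel symbols for
`D = δ`, the `∂̇`-Christoffel symbols for `D = ∂̇`. -/
def christoffel {n : ℕ} (D : Fin n → LFun n → LFun n) (g : Fin n → Fin n → LFun n)
    (α μ ν : Fin n) : LFun n :=
  fun x y => (1 / 2) * ∑ η, (Matrix.of fun a b => g a b x y)⁻¹ α η *
    (D μ (g ν η) x y + D ν (g μ η) x y - D η (g μ ν) x y)

/-- Coefficients `(F^α_{μν}, N^α_μ, C^α_{μν})` of a Finsler connection in a chart, written
`F α μ ν`, `N α μ`, `C α μ ν`. -/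
structure Conn (n : ℕ) where
  F : Fin n → Fin n → Fin n → LFun n
  N : Fin n → Fin n → LFun n
  C : Fin n → Fin n → Fin n → LFun n

/-- Two systems of coefficients coincide at all `(x, y)` with `x ∈ U` and `y ≠ 0`. -/
def Conn.AgreesOn {n : ℕ} (D D' : Conn n) (U : Set (Coord n)) : Prop :=
  ∀ x ∈ U, ∀ y : Coord n, y ≠ 0 →
    (∀ α μ ν, D.F α μ ν x y = D'.F α μ ν x y) ∧
    (∀ α μ, D.N α μ x y = D'.N α μ x y) ∧
    (∀ α μ ν, D.C α μ ν x y = D'.C α μ ν x y)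

/-- The common shape of the horizontal and vertical covariant derivatives of a tensor of
arbitrary type,
`D_ν X^{α…}_{μ…} + ∑_k X^{… η …}_{μ…} Γ^{α_k}_{ην} - ∑_l X^{α…}_{… η …} Γ^η_{μ_l ν}`. -/
def covDeriv {n r s : ℕ} (D : Fin n → LFun n → LFun n) (Γ : Fin n → Fin n → Fin n → LFun n)
    (X : Components n r s) (a : Fin r → Fin n) (m : Fin s → Fin n) (ν : Fin n) : LFun n :=
  fun x y => D ν (X a m) x y
    + ∑ k, ∑ η, X (Function.update a k η) m x y * Γ (a k) η ν x y
    - ∑ l, ∑ η, X a (Function.update m l η) x y * Γ η (m l) ν x y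

/-- The horizontal covariant derivative `X_{|ν}` of a Finsler connection. -/
def Conn.hCov {n r s : ℕ} (D : Conn n) (X : Components n r s)
    (a : Fin r → Fin n) (m : Fin s → Fin n) (ν : Fin n) : LFun n :=
  covDeriv (delta D.N) D.F X a m ν

/-- The vertical covariant derivative `X_{||ν}` of a Finsler connection. -/
def Conn.vCov {n r s : ℕ} (D : Conn n) (X : Components n r s)
    (a : Fin r → Fin n) (m : Fin s → Fin n) (ν : Fin n) : LFun n :=
  covDeriv vd D.C X a m ν

/-- The `(v)h`-torsion `R^α_{μν} = δ_ν N^α_μ - δ_μ N^α_ν`. -/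
def Conn.torsionR {n : ℕ} (D : Conn n) (α μ ν : Fin n) : LFun n :=
  fun x y => delta D.N ν (D.N α μ) x y - delta D.N μ (D.N α ν) x y

/-- The `(v)hv`-torsion `P^α_{μν} = ∂̇_ν N^α_μ - F^α_{μν}`. -/
def Conn.torsionP {n : ℕ} (D : Conn n) (α μ ν : Fin n) : LFun n :=
  fun x y => vd ν (D.N α μ) x y - D.F α μ ν x y

/-- The `h`-curvature
`R^α_{μνσ} = 𝔘_(ν,σ) {δ_σ F^α_{μν} + F^η_{μν} F^α_{ησ}} + C^α_{μη} R^η_{νσ}`. -/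
def Conn.hCurv {n : ℕ} (D : Conn n) (α μ ν σ : Fin n) : LFun n :=
  fun x y =>
    (delta D.N σ (D.F α μ ν) x y + ∑ η, D.F η μ ν x y * D.F α η σ x y)
    - (delta D.N ν (D.F α μ σ) x y + ∑ η, D.F η μ σ x y * D.F α η ν x y)
    + ∑ η, D.C α μ η x y * D.torsionR η ν σ x y

/-- The `hv`-curvature
`P^α_{μνσ} = ∂̇_σ F^α_{μν} - C^α_{μσ|ν} + C^α_{μη} P^η_{νσ}`. -/
def Conn.hvCurv {n : ℕ} (D : Conn n) (α μ ν σ : Fin n) : LFun n :=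
  fun x y =>
    vd σ (D.F α μ ν) x y
    - D.hCov (r := 1) (s := 2) (fun a m => D.C (a 0) (m 0) (m 1)) ![α] ![μ, σ] ν x y
    + ∑ η, D.C α μ η x y * D.torsionP η ν σ x y

/-! ### Finsler objects of a function `F(x, y)` -/

/-- The Finsler metric `g_{αβ} = ½ ∂̇_α ∂̇_β F²`. -/
def finslerMetric {n : ℕ} (F : LFun n) (α β : Fin n) : LFun n :=
  fun x y => (1 / 2) * vd α (vd β (fun x' y' => F x' y' ^ 2)) x y

/-- The canonical spray `G^α = ½ γ^α_{μν} y^μ y^ν`, with `γ` the formal Christoffel symbols. -/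
def spray {n : ℕ} (F : LFun n) (α : Fin n) : LFun n :=
  fun x y => (1 / 2) * ∑ μ, ∑ ν, christoffel pd (finslerMetric F) α μ ν x y * y μ * y ν

/-- The Barthel connection `N^α_β = ∂̇_β G^α`. -/
def barthel {n : ℕ} (F : LFun n) (α β : Fin n) : LFun n := vd β (spray F α)

/-- The Berwald linear connection `G^α_{σβ} = ∂̇_β N^α_σ`. -/
def berwaldG {n : ℕ} (F : LFun n) (α σ β : Fin n) : LFun n := vd β (barthel F α σ)

/-- The `δ`-Christoffel symbols `Γ̊^α_{μν}` of the Finsler metric. -/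
def deltaChristoffel {n : ℕ} (F : LFun n) (α μ ν : Fin n) : LFun n :=
  christoffel (delta (barthel F)) (finslerMetric F) α μ ν

/-- The `∂̇`-Christoffel symbols `C̊^α_{μν}` of the Finsler metric. -/
def dotChristoffel {n : ℕ} (F : LFun n) (α μ ν : Fin n) : LFun n :=
  christoffel vd (finslerMetric F) α μ ν

/-- The Cartan connection `(Γ̊^α_{μν}, N^α_μ, C̊^α_{μν})`. -/
def cartan {n : ℕ} (F : LFun n) : Conn n := ⟨deltaChristoffel F, barthel F, dotChristoffel F⟩

/-- The Berwald connection `(G^α_{μν}, N^α_μ, 0)`. -/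
def berwald {n : ℕ} (F : LFun n) : Conn n := ⟨berwaldG F, barthel F, fun _ _ _ _ _ => 0⟩

/-! ### Objects of a parallelization `λ_i^α(x, y)`, written `lam i α` -/

/-- `λ_{iμ}`, the inverse of the matrix `(λ_i^α)`:
`λ_i^α λ_{iβ} = δ^α_β` and `λ_i^α λ_{jα} = δ_{ij}`. -/
def coframe {n : ℕ} (lam : Fin n → Fin n → LFun n) (i μ : Fin n) : LFun n :=
  fun x y => (Matrix.of fun j α => lam j α x y)⁻¹ μ i

/-- The metric `g_{μν} = λ_{iμ} λ_{iν}`. -/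
def gapMetric {n : ℕ} (lam : Fin n → Fin n → LFun n) (μ ν : Fin n) : LFun n :=
  fun x y => ∑ i, coframe lam i μ x y * coframe lam i ν x y

/-- The Miron connection: the nonlinear connection `N` with the `δ`- and `∂̇`-Christoffel symbols
of the metric `λ_{iμ} λ_{iν}`. -/
def miron {n : ℕ} (lam : Fin n → Fin n → LFun n) (N : Fin n → Fin n → LFun n) : Conn n :=
  ⟨christoffel (delta N) (gapMetric lam), N, christoffel vd (gapMetric lam)⟩

/-- The `h`-contortion `A^α_{μν} = λ_i^α λ_{iμ|ν}`, with `|` for the Miron connection. -/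
def hContortion {n : ℕ} (lam : Fin n → Fin n → LFun n) (N : Fin n → Fin n → LFun n)
    (α μ ν : Fin n) : LFun n :=
  fun x y => ∑ i, lam i α x y *
    (miron lam N).hCov (r := 0) (s := 1) (fun _ m => coframe lam i (m 0)) ![] ![μ] ν x y

/-- The `v`-contortion `B^α_{μν} = λ_i^α λ_{iμ||ν}`, with `||` for the Miron connection. -/
def vContortion {n : ℕ} (lam : Fin n → Fin n → LFun n) (N : Fin n → Fin n → LFun n)
    (α μ ν : Fin n) : LFun n :=
  fun x y => ∑ i, lam i α x y *
    (miron lam N).vCov (r := 0) (s := 1) (fun _ m => coframe lam i (m 0)) ![] ![μ] ν x y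

/-- The vertical counterpart `C^α_{μν} = λ_i^α ∂̇_ν λ_{iμ}` of the canonical connection,
expressed through the parallelization. -/
def frameC {n : ℕ} (lam : Fin n → Fin n → LFun n) (α μ ν : Fin n) : LFun n :=
  fun x y => ∑ i, lam i α x y * vd ν (coframe lam i μ) x y

/-- The canonical connection: the Miron connection plus the contortions. -/
def canonical {n : ℕ} (lam : Fin n → Fin n → LFun n) (N : Fin n → Fin n → LFun n) : Conn n where
  F := fun α μ ν x y => (miron lam N).F α μ ν x y + hContortion lam N α μ ν x y
  N := N
  C := fun α μ ν x y => (miron lam N).C α μ ν x y + vContortion lam N α μ ν x y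

/-- The dual connection `(Γ^α_{νμ}, N^α_μ, C^α_{νμ})` of the canonical connection
`(Γ^α_{μν}, N^α_μ, C^α_{μν})`. -/
def dual {n : ℕ} (lam : Fin n → Fin n → LFun n) (N : Fin n → Fin n → LFun n) : Conn n where
  F := fun α μ ν => (canonical lam N).F α ν μ
  N := N
  C := fun α μ ν => (canonical lam N).C α ν μ

/-! ### Classical absolute parallelism geometry, where the frame depends on `x` only -/

/-- `∂f/∂x^μ` of a function of `x`. -/
def apPd {n : ℕ} (μ : Fin n) (f : Coord n → ℝ) (x : Coord n) : ℝ :=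
  fderiv ℝ f x (EuclideanSpace.single μ (1 : ℝ))

/-- `e_{iμ}`, the inverse of the matrix `(e_i^α)`, for a frame `e_i^α(x)`. -/
def apCoframe {n : ℕ} (e : Fin n → Fin n → Coord n → ℝ) (i μ : Fin n) (x : Coord n) : ℝ :=
  (Matrix.of fun j α => e j α x)⁻¹ μ i

/-- The canonical connection `Γ^α_{μν} = e_i^α ∂_ν e_{iμ}` of a classical absolute parallelism
space. -/
def apCanonical {n : ℕ} (e : Fin n → Fin n → Coord n → ℝ) (α μ ν : Fin n) (x : Coord n) : ℝ :=
  ∑ i, e i α x * apPd ν (apCoframe e i μ) x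

/-- The dual connection `Γ^α_{νμ} = e_i^α ∂_μ e_{iν}` of a classical absolute parallelism
space. -/
def apDual {n : ℕ} (e : Fin n → Fin n → Coord n → ℝ) (α μ ν : Fin n) (x : Coord n) : ℝ :=
  apCanonical e α ν μ x

/-- The covariant derivative of a tensor field `X(x)` of arbitrary type with respect to a linear
connection `Γ^α_{μν}(x)`. -/
def apCov {n r s : ℕ} (Γ : Fin n → Fin n → Fin n → Coord n → ℝ)
    (X : (Fin r → Fin n) → (Fin s → Fin n) → Coord n → ℝ)
    (a : Fin r → Fin n) (m : Fin s → Fin n) (ν : Fin n) (x : Coord n) : ℝ :=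
  apPd ν (X a m) x
    + ∑ k, ∑ η, X (Function.update a k η) m x * Γ (a k) η ν x
    - ∑ l, ∑ η, X a (Function.update m l η) x * Γ η (m l) ν x

/-! ### Manifolds -/

section Manifold

variable {n : ℕ} {M : Type*} [TopologicalSpace M] [ChartedSpace (Coord n) M]

/-- The point of `TM` with coordinates `(x, y)` in the chart of `TM` induced by `φ`. -/
def coordPoint (φ : OpenPartialHomeomorph M (Coord n)) (x y : Coord n) :
    TangentBundle (𝓡 n) M :=
  ⟨φ.symm x, mfderiv (𝓡 n) (𝓡 n) φ.symm x y⟩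

/-- The coordinate expression `F(x, y)` of a function on `TM`. -/
def coordFun (φ : OpenPartialHomeomorph M (Coord n)) (F : TangentBundle (𝓡 n) M → ℝ) : LFun n :=
  fun x y => F (coordPoint φ x y)

/-- The components `s^α(x, y)`, in the natural basis of the chart `φ`, of a section `s` of the
pullback of `TM → M` along `TM → M`. -/
def coordSection (φ : OpenPartialHomeomorph M (Coord n))
    (s : (u : TangentBundle (𝓡 n) M) → TangentSpace (𝓡 n) u.proj) (α : Fin n) : LFun n :=
  fun x y =>
    (show Coord n from mfderiv (𝓡 n) (𝓡 n) φ (φ.symm x) (s (coordPoint φ x y))) α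

end Manifold

/-- A Finslerized parallelizable space `(M, λ_i(x, y), F(x, y))`: smooth, pointwise independent
sections `λ_1, …, λ_n` of the pullback bundle over the slit tangent bundle (their values on the
zero section are irrelevant), positively homogeneous of degree `0`, such that `∂̇_α g_{μν}` is
totally symmetric for `g_{μν} = λ_{iμ} λ_{iν}`, together with `F = √(g_{μν} y^μ y^ν)`. -/
structure FPSpace (n : ℕ) (M : Type*) [TopologicalSpace M] [ChartedSpace (Coord n) M] where
  lam : Fin n → (u : TangentBundle (𝓡 n) M) → TangentSpace (𝓡 n) u.proj
  F : TangentBundle (𝓡 n) M → ℝ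
  smooth : ∀ φ ∈ IsManifold.maximalAtlas (𝓡 n) ∞ M, ∀ i α,
    ContDiffOn ℝ ∞ (fun q : Coord n × Coord n => coordSection φ (lam i) α q.1 q.2)
      {q | q.1 ∈ φ.target ∧ q.2 ≠ 0}
  independent : ∀ (p : M) (v : TangentSpace (𝓡 n) p), v ≠ 0 →
    LinearIndependent ℝ (fun i => (lam i ⟨p, v⟩ : TangentSpace (𝓡 n) p))
  homogeneous : ∀ i (p : M) (v : TangentSpace (𝓡 n) p), v ≠ 0 → ∀ a : ℝ, 0 < a →
    (lam i ⟨p, a • v⟩ : TangentSpace (𝓡 n) p) = lam i ⟨p, v⟩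
  /-- As `g` is symmetric, exchanging the first two indices gives total symmetry. -/
  totally_symmetric : ∀ φ ∈ IsManifold.maximalAtlas (𝓡 n) ∞ M,
    ∀ x ∈ φ.target, ∀ y : Coord n, y ≠ 0 → ∀ α μ ν,
      vd α (gapMetric (fun i β => coordSection φ (lam i) β) μ ν) x y =
        vd μ (gapMetric (fun i β => coordSection φ (lam i) β) α ν) x y
  F_eq : ∀ φ ∈ IsManifold.maximalAtlas (𝓡 n) ∞ M, ∀ x ∈ φ.target, ∀ y : Coord n,
    coordFun φ F x y =
      Real.sqrt (∑ μ, ∑ ν, gapMetric (fun i β => coordSection φ (lam i) β) μ ν x y * y μ * y ν)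

section FPSpace

variable {n : ℕ} {M : Type*} [TopologicalSpace M] [ChartedSpace (Coord n) M]

/-- The components `λ_i^α(x, y)` in a chart. -/
def FPSpace.frame (S : FPSpace n M) (φ : OpenPartialHomeomorph M (Coord n)) :
    Fin n → Fin n → LFun n :=
  fun i α => coordSection φ (S.lam i) α

/-- The function `F(x, y)` in a chart. -/
def FPSpace.fundamental (S : FPSpace n M) (φ : OpenPartialHomeomorph M (Coord n)) : LFun n :=
  coordFun φ S.F

/-- The frame `x ↦ λ_i^α(x, y)` for a fixed value of the coordinates `y`. -/
def FPSpace.frozenFrame (S : FPSpace n M) (φ : OpenPartialHomeomorph M (Coord n)) (y : Coord n) :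
    Fin n → Fin n → Coord n → ℝ :=
  fun i α x => S.frame φ i α x y

/-- An FP-Minkowskian manifold: the `h`- and `hv`-curvature tensors of the Cartan connection
vanish. -/
def FPSpace.IsMinkowskian (S : FPSpace n M) : Prop :=
  ∀ φ ∈ IsManifold.maximalAtlas (𝓡 n) ∞ M, ∀ x ∈ φ.target, ∀ y : Coord n, y ≠ 0 →
    ∀ α μ ν σ, (cartan (S.fundamental φ)).hvCurv α μ ν σ x y = 0 ∧
      (cartan (S.fundamental φ)).hCurv α μ ν σ x y = 0

/-- A natural coordinate system: a smooth chart in whose induced coordinates on `TM` the function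
`F` depends on `y` only. -/
def FPSpace.IsNaturalChart (S : FPSpace n M) (φ : OpenPartialHomeomorph M (Coord n)) : Prop :=
  φ ∈ IsManifold.maximalAtlas (𝓡 n) ∞ M ∧
    ∃ f : Coord n → ℝ, ∀ x ∈ φ.target, ∀ y, S.fundamental φ x y = f y

/-- The Barthel connection in a chart; it is the nonlinear connection of the FP-space. -/
def FPSpace.N (S : FPSpace n M) (φ : OpenPartialHomeomorph M (Coord n)) :
    Fin n → Fin n → LFun n :=
  barthel (S.fundamental φ)

/-- The Cartan connection in a chart. -/
def FPSpace.cartan (S : FPSpace n M) (φ : OpenPartialHomeomorph M (Coord n)) : Conn n :=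
  FP.cartan (S.fundamental φ)

/-- The Berwald connection in a chart. -/
def FPSpace.berwald (S : FPSpace n M) (φ : OpenPartialHomeomorph M (Coord n)) : Conn n :=
  FP.berwald (S.fundamental φ)

/-- The Miron connection in a chart. -/
def FPSpace.miron (S : FPSpace n M) (φ : OpenPartialHomeomorph M (Coord n)) : Conn n :=
  FP.miron (S.frame φ) (S.N φ)

/-- The canonical connection in a chart. -/
def FPSpace.canonical (S : FPSpace n M) (φ : OpenPartialHomeomorph M (Coord n)) : Conn n :=
  FP.canonical (S.frame φ) (S.N φ)

/-- The dual connection in a chart. -/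
def FPSpace.dual (S : FPSpace n M) (φ : OpenPartialHomeomorph M (Coord n)) : Conn n :=
  FP.dual (S.frame φ) (S.N φ)

/-- The `h`-contortion `A^α_{μν}` in a chart. -/
def FPSpace.A (S : FPSpace n M) (φ : OpenPartialHomeomorph M (Coord n)) :
    Fin n → Fin n → Fin n → LFun n :=
  hContortion (S.frame φ) (S.N φ)

end FPSpace

end

end FP

/-!
In a natural chart `F` depends on `y` only, hence so does the Finsler metric `½ ∂̇_μ ∂̇_ν F²`. Its
`∂`-derivatives vanish, so the formal Christoffel symbols, the spray, the Barthel connection `N` and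
the Berwald coefficients vanish one after the other. With `N = 0` the operators `δ_μ` and `∂_μ`
coincide, which kills the `δ`-Christoffel symbols of the Finsler metric and turns the horizontal
covariant derivatives of the Cartan and Berwald connections into partial derivatives.

The same conclusion for the Miron connection needs `λ_{iμ} λ_{iν}` to be the Finsler metric
(`FPSpace.finslerMetric_eq_gapMetric`). Here the axioms of an FP-space enter: `g = λ_{iμ} λ_{iν}` is
homogeneous of degree `0` in `y`, so `y^α ∂̇_α g_{μν} = 0` by Euler's relation, and by total symmetry
`y^μ ∂̇_α g_{μν} = 0` as well. Differentiating `F² = g_{μν} y^μ y^ν` twice therefore only leaves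
`2 g_{αβ}`.

Finally, since `λ_i^α λ_{iη} = δ^α_η`, the contortions are `λ_i^α δ_ν λ_{iμ}` and
`λ_i^α ∂̇_ν λ_{iμ}` minus the coefficients of the Miron connection
(`sum_lam_mul_covDeriv_coframe`). Adding the Miron connection leaves `λ_i^α δ_ν λ_{iμ}` and
`λ_i^α ∂̇_ν λ_{iμ}`, and `δ_ν = ∂_ν` gives the classical expressions.
-/

namespace FP

open scoped Topology

/-! ### Functions independent of the position -/

section PositionIndependent

variable {n : ℕ} {U : Set (Coord n)}

lemma pd_eq_zero_of_eqOn (hU : IsOpen U) {f : LFun n} {y : Coord n} {c : ℝ}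
    (h : ∀ x ∈ U, f x y = c) (μ : Fin n) {x : Coord n} (hx : x ∈ U) : pd μ f x y = 0 := by
  have h' : (fun x' => f x' y) =ᶠ[𝓝 x] fun _ => c :=
    Filter.eventually_of_mem (hU.mem_nhds hx) h
  simp [pd, h'.fderiv_eq]

lemma vd_congr {f g : LFun n} {x y : Coord n} (h : ∀ᶠ y' in 𝓝 y, f x y' = g x y') (μ : Fin n) :
    vd μ f x y = vd μ g x y := by
  have h' : (fun y' => f x y') =ᶠ[𝓝 y] fun y' => g x y' := h
  simp [vd, h'.fderiv_eq]

lemma delta_eq_pd {N : Fin n → Fin n → LFun n} {x y : Coord n} (h : ∀ α μ, N α μ x y = 0)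
    (μ : Fin n) (f : LFun n) : delta N μ f x y = pd μ f x y := by
  simp [delta, h]

lemma christoffel_eq_zero {D : Fin n → LFun n → LFun n} {g : Fin n → Fin n → LFun n}
    {x y : Coord n} (h : ∀ η μ ν, D η (g μ ν) x y = 0) (α μ ν : Fin n) :
    christoffel D g α μ ν x y = 0 := by
  simp [christoffel, h]

variable {F : LFun n} {f : Coord n → ℝ}

/-- A position-independent `F` has a position-independent Finsler metric; the position `0` on the
right is an arbitrary choice. -/
lemma finslerMetric_eq_of_position_independent (h : ∀ x ∈ U, ∀ y, F x y = f y) (α β : Fin n)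
    {x : Coord n} (hx : x ∈ U) (y : Coord n) :
    finslerMetric F α β x y = finslerMetric (fun _ => f) α β 0 y := by
  simp [finslerMetric, vd, h x hx]

lemma pd_finslerMetric_eq_zero (hU : IsOpen U) (h : ∀ x ∈ U, ∀ y, F x y = f y) (η α β : Fin n)
    {x : Coord n} (hx : x ∈ U) (y : Coord n) : pd η (finslerMetric F α β) x y = 0 :=
  pd_eq_zero_of_eqOn hU
    (fun _ hx' => finslerMetric_eq_of_position_independent h α β hx' y) η hx

lemma spray_eq_zero (hU : IsOpen U) (h : ∀ x ∈ U, ∀ y, F x y = f y) (α : Fin n)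
    {x : Coord n} (hx : x ∈ U) (y : Coord n) : spray F α x y = 0 := by
  have h0 : ∀ μ ν, christoffel pd (finslerMetric F) α μ ν x y = 0 :=
    christoffel_eq_zero (fun η μ ν => pd_finslerMetric_eq_zero hU h η μ ν hx y) α
  simp [spray, h0]

lemma barthel_eq_zero (hU : IsOpen U) (h : ∀ x ∈ U, ∀ y, F x y = f y) (α β : Fin n)
    {x : Coord n} (hx : x ∈ U) (y : Coord n) : barthel F α β x y = 0 := by
  simp [barthel, vd, spray_eq_zero hU h α hx]

lemma berwaldG_eq_zero (hU : IsOpen U) (h : ∀ x ∈ U, ∀ y, F x y = f y) (α σ β : Fin n)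
    {x : Coord n} (hx : x ∈ U) (y : Coord n) : berwaldG F α σ β x y = 0 := by
  simp [berwaldG, vd, barthel_eq_zero hU h α σ hx]

lemma deltaChristoffel_eq_zero (hU : IsOpen U) (h : ∀ x ∈ U, ∀ y, F x y = f y) (α μ ν : Fin n)
    {x : Coord n} (hx : x ∈ U) (y : Coord n) : deltaChristoffel F α μ ν x y = 0 :=
  christoffel_eq_zero (fun η a b => by
    rw [delta_eq_pd (fun c d => barthel_eq_zero hU h c d hx y),
      pd_finslerMetric_eq_zero hU h η a b hx y]) α μ ν

lemma hCov_eq_pd {r s : ℕ} (D : Conn n) {x y : Coord n} (hF : ∀ α μ ν, D.F α μ ν x y = 0)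
    (hN : ∀ α μ, D.N α μ x y = 0) (X : Components n r s) (a : Fin r → Fin n)
    (m : Fin s → Fin n) (ν : Fin n) : D.hCov X a m ν x y = pd ν (X a m) x y := by
  simp [Conn.hCov, covDeriv, hF, delta_eq_pd hN]

/-- Once `N = 0`, the variable `y` enters a horizontal covariant derivative only as a parameter. -/
lemma hCov_eq_apCov {r s : ℕ} (D : Conn n) {Γ : Fin n → Fin n → Fin n → Coord n → ℝ}
    {x y : Coord n} (hF : ∀ α μ ν, D.F α μ ν x y = Γ α μ ν x) (hN : ∀ α μ, D.N α μ x y = 0)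
    (X : Components n r s) (a : Fin r → Fin n) (m : Fin s → Fin n) (ν : Fin n) :
    D.hCov X a m ν x y = apCov Γ (fun a' m' x' => X a' m' x' y) a m ν x := by
  simp [Conn.hCov, covDeriv, apCov, hF, delta_eq_pd hN, pd, apPd]

end PositionIndependent

/-! ### The Hessian of a homogeneous quadratic form with totally symmetric derivative -/

section Hessian

variable {n : ℕ}

/-- Euler's relation in degree `0`. -/
lemma sum_mul_vd_eq_zero {f : LFun n} {x y : Coord n}
    (hd : DifferentiableAt ℝ (f x) y) (hom : ∀ a : ℝ, 0 < a → f x (a • y) = f x y) :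
    ∑ μ, y μ * vd μ f x y = 0 := by
  have hy : ∑ μ, y μ • EuclideanSpace.single μ (1 : ℝ) = y := by
    simpa using (EuclideanSpace.basisFun (Fin n) ℝ).sum_repr y
  have h1 : ∑ μ, y μ * vd μ f x y = fderiv ℝ (f x) y y := by
    conv_rhs => rw [← hy, map_sum]
    simp [vd, hy]
  have hc : HasDerivAt (fun a : ℝ => a • y) y 1 := by
    simpa using (hasDerivAt_id (1 : ℝ)).smul_const y
  have hd' : HasFDerivAt (f x) (fderiv ℝ (f x) y) ((1 : ℝ) • y) := by
    simpa using hd.hasFDerivAt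
  have h2 : HasDerivAt (fun a : ℝ => f x (a • y)) (fderiv ℝ (f x) y y) 1 :=
    hd'.comp_hasDerivAt (1 : ℝ) hc
  have h3 : (fun a : ℝ => f x (a • y)) =ᶠ[𝓝 1] fun _ => f x y :=
    Filter.eventually_of_mem (Ioi_mem_nhds one_pos) hom
  rw [h1, ← h2.deriv, h3.deriv_eq, deriv_const]

lemma hasFDerivAt_coord (μ : Fin n) (y : Coord n) :
    HasFDerivAt (fun y' : Coord n => y' μ) (EuclideanSpace.proj μ : Coord n →L[ℝ] ℝ) y :=
  (EuclideanSpace.proj μ : Coord n →L[ℝ] ℝ).hasFDerivAt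

variable {g : Fin n → Fin n → LFun n} {x : Coord n}

/-- By total symmetry, Euler's relation also holds with `y` contracted into an index of `g`. -/
lemma sum_mul_vd_metric_eq_zero
    (hd : ∀ μ ν, ∀ y ≠ 0, DifferentiableAt ℝ (g μ ν x) y)
    (hom : ∀ μ ν, ∀ y ≠ 0, ∀ a : ℝ, 0 < a → g μ ν x (a • y) = g μ ν x y)
    (hts : ∀ y ≠ 0, ∀ α μ ν, vd α (g μ ν) x y = vd μ (g α ν) x y)
    {y : Coord n} (hy : y ≠ 0) (α ν : Fin n) : ∑ μ, y μ * vd α (g μ ν) x y = 0 := by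
  simp_rw [hts y hy α _ ν]
  exact sum_mul_vd_eq_zero (hd α ν y hy) (hom α ν y hy)

/-- The terms in which the derivative falls on `g` cancel by Euler's relation. -/
lemma vd_quadratic_form
    (symm : ∀ μ ν, g μ ν = g ν μ)
    (hd : ∀ μ ν, ∀ y ≠ 0, DifferentiableAt ℝ (g μ ν x) y)
    (hom : ∀ μ ν, ∀ y ≠ 0, ∀ a : ℝ, 0 < a → g μ ν x (a • y) = g μ ν x y)
    (hts : ∀ y ≠ 0, ∀ α μ ν, vd α (g μ ν) x y = vd μ (g α ν) x y)
    {y : Coord n} (hy : y ≠ 0) (β : Fin n) :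
    vd β (fun x y => ∑ μ, ∑ ν, g μ ν x y * y μ * y ν) x y = 2 * ∑ μ, g β μ x y * y μ := by
  have hD : HasFDerivAt (fun y' => ∑ μ, ∑ ν, g μ ν x y' * y' μ * y' ν) _ y :=
    HasFDerivAt.fun_sum fun μ _ => HasFDerivAt.fun_sum fun ν _ =>
      ((hd μ ν y hy).hasFDerivAt.mul (hasFDerivAt_coord μ y)).mul (hasFDerivAt_coord ν y)
  have h0 : ∑ μ, ∑ ν, y ν * (y μ * vd β (g μ ν) x y) = 0 := by
    rw [Finset.sum_comm]
    simp_rw [← Finset.mul_sum, sum_mul_vd_metric_eq_zero hd hom hts hy, mul_zero,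
      Finset.sum_const_zero]
  have h1 : vd β (fun x y => ∑ μ, ∑ ν, g μ ν x y * y μ * y ν) x y =
      ∑ μ, ∑ ν, y ν * (y μ * vd β (g μ ν) x y) +
        (∑ μ, ∑ ν, y ν * (if μ = β then g μ ν x y else 0) +
          ∑ μ, ∑ ν, y μ * (if ν = β then g μ ν x y else 0)) := by
    rw [vd, hD.fderiv]
    simp only [sum_apply, ← Finset.sum_add_distrib]
    refine Finset.sum_congr rfl fun μ _ => Finset.sum_congr rfl fun ν _ => ?_
    simp [vd]
    split_ifs <;> ring
  rw [h1, h0]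
  have h2 : ∑ μ, ∑ ν, y ν * (if μ = β then g μ ν x y else 0) = ∑ ν, g β ν x y * y ν := by
    rw [Finset.sum_comm]
    simp [mul_comm]
  have h3 : ∑ μ, ∑ ν, y μ * (if ν = β then g μ ν x y else 0) = ∑ ν, g β ν x y * y ν := by
    simp [symm β, mul_comm]
  rw [h2, h3]
  ring

/-- If the matrix `g` is symmetric, homogeneous of degree `0` and has totally symmetric vertical
derivative, then it is half the vertical Hessian of its quadratic form. -/
lemma half_vd_vd_quadratic_form
    (symm : ∀ μ ν, g μ ν = g ν μ)
    (hd : ∀ μ ν, ∀ y ≠ 0, DifferentiableAt ℝ (g μ ν x) y)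
    (hom : ∀ μ ν, ∀ y ≠ 0, ∀ a : ℝ, 0 < a → g μ ν x (a • y) = g μ ν x y)
    (hts : ∀ y ≠ 0, ∀ α μ ν, vd α (g μ ν) x y = vd μ (g α ν) x y)
    {y : Coord n} (hy : y ≠ 0) (α β : Fin n) :
    (1 / 2) * vd α (vd β (fun x y => ∑ μ, ∑ ν, g μ ν x y * y μ * y ν)) x y = g α β x y := by
  have hev : ∀ᶠ y' in 𝓝 y, vd β (fun x y => ∑ μ, ∑ ν, g μ ν x y * y μ * y ν) x y' =
      (fun x y => 2 * ∑ μ, g β μ x y * y μ) x y' :=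
    Filter.eventually_of_mem (isOpen_ne.mem_nhds hy)
      fun y' hy' => vd_quadratic_form symm hd hom hts hy' β
  rw [vd_congr (g := fun x y => 2 * ∑ μ, g β μ x y * y μ) hev]
  have hD : HasFDerivAt (fun y' => 2 * ∑ μ, g β μ x y' * y' μ) _ y :=
    (HasFDerivAt.fun_sum fun μ _ =>
      (hd β μ y hy).hasFDerivAt.mul (hasFDerivAt_coord μ y)).const_mul 2
  have h0 : ∑ μ, y μ * vd α (g β μ) x y = 0 := by
    simp_rw [symm β]
    exact sum_mul_vd_metric_eq_zero hd hom hts hy α β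
  have h1 : vd α (fun x y => 2 * ∑ μ, g β μ x y * y μ) x y =
      2 * (∑ μ, y μ * vd α (g β μ) x y + ∑ μ, if μ = α then g β μ x y else 0) := by
    rw [vd, hD.fderiv]
    simp only [sum_apply, ← Finset.sum_add_distrib,
      smul_apply, smul_eq_mul]
    congr 1
    refine Finset.sum_congr rfl fun μ _ => ?_
    simp [vd]
    split_ifs <;> ring
  rw [h1, h0]
  simp [symm α β]

end Hessian

/-! ### The coframe -/

section Coframe

variable {n : ℕ} {lam : Fin n → Fin n → LFun n} {x : Coord n}

lemma sum_lam_mul_coframe {y : Coord n}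
    (hdet : (Matrix.of fun j α => lam j α x y).det ≠ 0) (α μ : Fin n) :
    ∑ i, lam i α x y * coframe lam i μ x y = if α = μ then 1 else 0 := by
  have h := congrFun (congrFun
    (Matrix.nonsing_inv_mul (Matrix.of fun j α => lam j α x y) hdet.isUnit) μ) α
  simp only [Matrix.mul_apply, Matrix.of_apply, Matrix.one_apply] at h
  simp_rw [coframe, eq_comm (a := α), ← h, mul_comm]

lemma differentiableAt_det {E : Type*} [NormedAddCommGroup E] [NormedSpace ℝ E]
    {A : E → Matrix (Fin n) (Fin n) ℝ} {p : E}
    (h : ∀ i j, DifferentiableAt ℝ (fun q => A q i j) p) :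
    DifferentiableAt ℝ (fun q => (A q).det) p := by
  simp_rw [Matrix.det_apply']
  exact DifferentiableAt.fun_sum fun σ _ =>
    (HasFDerivAt.finsetProd fun i _ => (h (σ i) i).hasFDerivAt).differentiableAt.const_mul _

lemma differentiableAt_coframe {y : Coord n}
    (hdet : (Matrix.of fun j α => lam j α x y).det ≠ 0)
    (hd : ∀ i α, DifferentiableAt ℝ (lam i α x) y) (i μ : Fin n) :
    DifferentiableAt ℝ (coframe lam i μ x) y := by
  have h : coframe lam i μ x = fun y => (Matrix.of fun j α => lam j α x y).det⁻¹ *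
      ((Matrix.of fun j α => lam j α x y).updateRow i (Pi.single μ 1)).det := by
    funext y
    simp [coframe, Matrix.inv_def, Matrix.adjugate_apply]
  rw [h]
  refine ((differentiableAt_det fun a b => hd a b).inv hdet).mul
    (differentiableAt_det fun a b => ?_)
  by_cases ha : a = i
  · subst ha
    simp
  · simpa [Matrix.updateRow_ne ha] using hd a b

lemma gapMetric_comm (μ ν : Fin n) : gapMetric lam μ ν = gapMetric lam ν μ := by
  funext x y
  simp [gapMetric, mul_comm]

/-- The quadratic form is `∑ i, (λ_{iμ} y^μ) ^ 2`, so the square root defining `F` is not taken of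
a negative number. -/
lemma quadratic_form_gapMetric_nonneg (x y : Coord n) :
    0 ≤ ∑ μ, ∑ ν, gapMetric lam μ ν x y * y μ * y ν := by
  have h : ∑ μ, ∑ ν, gapMetric lam μ ν x y * y μ * y ν =
      ∑ i, (∑ μ, coframe lam i μ x y * y μ) ^ 2 := by
    simp_rw [gapMetric, sq, Finset.sum_mul_sum, Finset.sum_mul]
    refine .trans ?_ Finset.sum_comm
    refine Finset.sum_congr rfl fun μ _ => ?_
    rw [Finset.sum_comm]
    exact Finset.sum_congr rfl fun i _ => Finset.sum_congr rfl fun ν _ => by ring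
  rw [h]
  positivity

/-- The contortion of a covariant derivative is the frame expression `λ_i^α D_ν λ_{iμ}` minus the
coefficients of the connection. -/
lemma sum_lam_mul_covDeriv_coframe {y : Coord n}
    (hdet : (Matrix.of fun j α => lam j α x y).det ≠ 0) (D : Fin n → LFun n → LFun n)
    (Γ : Fin n → Fin n → Fin n → LFun n) (α μ ν : Fin n) :
    ∑ i, lam i α x y *
        covDeriv (r := 0) (s := 1) D Γ (fun _ m => coframe lam i (m 0)) ![] ![μ] ν x y =
      ∑ i, lam i α x y * D ν (coframe lam i μ) x y - Γ α μ ν x y := by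
  have h : ∑ i, ∑ η, lam i α x y * (coframe lam i η x y * Γ η μ ν x y) = Γ α μ ν x y := by
    rw [Finset.sum_comm]
    simp_rw [← mul_assoc, ← Finset.sum_mul, sum_lam_mul_coframe hdet]
    simp
  simp [covDeriv, mul_sub, Finset.mul_sum, h]

/-- The horizontal coefficients of the canonical connection are `λ_i^α δ_ν λ_{iμ}`. -/
lemma canonical_F_eq {N : Fin n → Fin n → LFun n} {y : Coord n}
    (hdet : (Matrix.of fun j α => lam j α x y).det ≠ 0) (α μ ν : Fin n) :
    (canonical lam N).F α μ ν x y = ∑ i, lam i α x y * delta N ν (coframe lam i μ) x y := by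
  have h := sum_lam_mul_covDeriv_coframe hdet (delta (miron lam N).N) (miron lam N).F α μ ν
  simp only [canonical, hContortion, Conn.hCov, h]
  simp [miron]

lemma canonical_C_eq {N : Fin n → Fin n → LFun n} {y : Coord n}
    (hdet : (Matrix.of fun j α => lam j α x y).det ≠ 0) (α μ ν : Fin n) :
    (canonical lam N).C α μ ν x y = frameC lam α μ ν x y := by
  have h := sum_lam_mul_covDeriv_coframe hdet vd (miron lam N).C α μ ν
  simp [canonical, vContortion, Conn.vCov, h, frameC]

end Coframe

/-! ### The parallelization of an FP-space in a chart -/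

section Chart

variable {n : ℕ} {M : Type*} [TopologicalSpace M] [ChartedSpace (Coord n) M]
  {φ : OpenPartialHomeomorph M (Coord n)}

lemma mdifferentiable_of_mem_maximalAtlas (hφ : φ ∈ IsManifold.maximalAtlas (𝓡 n) ∞ M) :
    φ.MDifferentiable (𝓡 n) (𝓡 n) :=
  ⟨(contMDiffOn_of_mem_maximalAtlas hφ).mdifferentiableOn (by simp),
    (contMDiffOn_symm_of_mem_maximalAtlas hφ).mdifferentiableOn (by simp)⟩

lemma mfderiv_symm_ne_zero (hφ : φ ∈ IsManifold.maximalAtlas (𝓡 n) ∞ M) {x y : Coord n}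
    (hx : x ∈ φ.target) (hy : y ≠ 0) : mfderiv (𝓡 n) (𝓡 n) φ.symm x y ≠ 0 := by
  intro h
  exact hy ((mdifferentiable_of_mem_maximalAtlas hφ).symm.mfderiv_injective (x := x) hx
    (h.trans (map_zero _).symm))

lemma FPSpace.frame_smul (S : FPSpace n M) (hφ : φ ∈ IsManifold.maximalAtlas (𝓡 n) ∞ M)
    {x y : Coord n} (hx : x ∈ φ.target) (hy : y ≠ 0) {a : ℝ} (ha : 0 < a) (i α : Fin n) :
    S.frame φ i α x (a • y) = S.frame φ i α x y := by
  have h := S.homogeneous i (φ.symm x) (mfderiv (𝓡 n) (𝓡 n) φ.symm x y)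
    (mfderiv_symm_ne_zero hφ hx hy) a ha
  have hp : coordPoint φ x (a • y) =
      ⟨φ.symm x, a • (mfderiv (𝓡 n) (𝓡 n) φ.symm x y : TangentSpace (𝓡 n) (φ.symm x))⟩ := by
    unfold coordPoint
    exact congrArg _ (map_smul (mfderiv (𝓡 n) (𝓡 n) φ.symm x) a y)
  simp only [FPSpace.frame, coordSection]
  rw [hp, h]
  rfl

lemma FPSpace.det_frame_ne_zero (S : FPSpace n M)
    (hφ : φ ∈ IsManifold.maximalAtlas (𝓡 n) ∞ M) {x y : Coord n} (hx : x ∈ φ.target)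
    (hy : y ≠ 0) : (Matrix.of fun j α => S.frame φ j α x y).det ≠ 0 := by
  have hli := S.independent (φ.symm x) (mfderiv (𝓡 n) (𝓡 n) φ.symm x y)
    (mfderiv_symm_ne_zero hφ hx hy)
  have hinj := (mdifferentiable_of_mem_maximalAtlas hφ).mfderiv_injective (φ.map_target hx)
  have h1 := hli.map' (mfderiv (𝓡 n) (𝓡 n) φ (φ.symm x)).toLinearMap
    (LinearMap.ker_eq_bot.mpr hinj)
  have h2 := h1.map' (EuclideanSpace.equiv (Fin n) ℝ).toLinearEquiv.toLinearMap
    (LinearEquiv.ker _)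
  have h3 : LinearIndependent ℝ (Matrix.of fun j α => S.frame φ j α x y).row := h2
  exact ((Matrix.isUnit_iff_isUnit_det _).mp
    (Matrix.linearIndependent_rows_iff_isUnit.mp h3)).ne_zero

lemma FPSpace.differentiableAt_frame (S : FPSpace n M)
    (hφ : φ ∈ IsManifold.maximalAtlas (𝓡 n) ∞ M) {x y : Coord n} (hx : x ∈ φ.target)
    (hy : y ≠ 0) (i α : Fin n) : DifferentiableAt ℝ (S.frame φ i α x) y := by
  have hopen : IsOpen {q : Coord n × Coord n | q.1 ∈ φ.target ∧ q.2 ≠ 0} :=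
    φ.open_target.prod isOpen_ne
  have h : DifferentiableAt ℝ
      (fun q : Coord n × Coord n => coordSection φ (S.lam i) α q.1 q.2) (x, y) :=
    ((S.smooth φ hφ i α).contDiffAt (hopen.mem_nhds ⟨hx, hy⟩)).differentiableAt (by simp)
  exact h.comp y (differentiableAt_const x |>.prodMk differentiableAt_id)

/-- The metric of the parallelization is the Finsler metric: `F²` is the quadratic form of
`g_{μν} = λ_{iμ} λ_{iν}`, and `half_vd_vd_quadratic_form` recovers `g` from it. -/
lemma FPSpace.finslerMetric_eq_gapMetric (S : FPSpace n M)
    (hφ : φ ∈ IsManifold.maximalAtlas (𝓡 n) ∞ M) {x y : Coord n} (hx : x ∈ φ.target)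
    (hy : y ≠ 0) (α β : Fin n) :
    finslerMetric (S.fundamental φ) α β x y = gapMetric (S.frame φ) α β x y := by
  have hsq : ∀ y', S.fundamental φ x y' ^ 2 =
      ∑ μ, ∑ ν, gapMetric (S.frame φ) μ ν x y' * y' μ * y' ν := fun y' => by
    rw [FPSpace.fundamental, S.F_eq φ hφ x hx y']
    exact Real.sq_sqrt (quadratic_form_gapMetric_nonneg x y')
  rw [← half_vd_vd_quadratic_form (g := gapMetric (S.frame φ)) gapMetric_comm ?_ ?_
    (S.totally_symmetric φ hφ x hx) hy α β]
  · simp [finslerMetric, vd, hsq]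
  · exact fun μ ν y hy => DifferentiableAt.fun_sum fun i _ =>
      (differentiableAt_coframe (S.det_frame_ne_zero hφ hx hy)
        (S.differentiableAt_frame hφ hx hy) i μ).mul
      (differentiableAt_coframe (S.det_frame_ne_zero hφ hx hy)
        (S.differentiableAt_frame hφ hx hy) i ν)
  · intro μ ν y hy a ha
    have h := fun i α => S.frame_smul hφ hx hy ha i α
    simp [gapMetric, coframe, h]

end Chart

end FP

theorem theorem4p10 {n : ℕ} {M : Type*} [TopologicalSpace M] [ChartedSpace (FP.Coord n) M]
    [IsManifold (𝓡 n) ∞ M] (S : FP.FPSpace n M) (hS : S.IsMinkowskian)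
    (φ : OpenPartialHomeomorph M (FP.Coord n)) (hφ : S.IsNaturalChart φ) :
    -- (a) the Barthel connection vanishes
    (∀ x ∈ φ.target, ∀ y : FP.Coord n, y ≠ 0 → ∀ α β,
      FP.barthel (S.fundamental φ) α β x y = 0) ∧
    -- (b) the delta-Christoffel symbols (of the Finsler metric and of the metric of the
    -- parallelization) vanish
    (∀ x ∈ φ.target, ∀ y : FP.Coord n, y ≠ 0 → ∀ α μ ν,
      FP.deltaChristoffel (S.fundamental φ) α μ ν x y = 0 ∧ (S.miron φ).F α μ ν x y = 0) ∧
    -- (c) the Berwald connection vanishes, the Cartan connection is (0, 0, C)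
    (S.berwald φ).AgreesOn ⟨fun _ _ _ _ _ => 0, fun _ _ _ _ => 0, fun _ _ _ _ _ => 0⟩ φ.target ∧
    (S.cartan φ).AgreesOn ⟨fun _ _ _ _ _ => 0, fun _ _ _ _ => 0,
      FP.dotChristoffel (S.fundamental φ)⟩ φ.target ∧
    -- (d) the h-covariant derivatives of the Cartan and Berwald connections are partial derivatives
    (∀ (r s : ℕ) (X : FP.Components n r s) (a : Fin r → Fin n) (m : Fin s → Fin n) (ν : Fin n),
      ∀ x ∈ φ.target, ∀ y : FP.Coord n, y ≠ 0 →
        (S.cartan φ).hCov X a m ν x y = FP.pd ν (X a m) x y ∧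
        (S.berwald φ).hCov X a m ν x y = FP.pd ν (X a m) x y) ∧
    -- (e) the canonical and the dual connections
    (S.canonical φ).AgreesOn ⟨S.A φ, fun _ _ _ _ => 0, FP.frameC (S.frame φ)⟩ φ.target ∧
    (S.dual φ).AgreesOn ⟨fun α μ ν => S.A φ α ν μ, fun _ _ _ _ => 0,
      fun α μ ν => FP.frameC (S.frame φ) α ν μ⟩ φ.target ∧
    -- (f) their horizontal parts have the classical form, with y as a parameter
    (∀ x ∈ φ.target, ∀ y : FP.Coord n, y ≠ 0 → ∀ α μ ν,
      (S.canonical φ).F α μ ν x y = FP.apCanonical (S.frozenFrame φ y) α μ ν x ∧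
      (S.dual φ).F α μ ν x y = FP.apDual (S.frozenFrame φ y) α μ ν x) ∧
    -- (g) their h-covariant derivatives have the classical form, with y as a parameter
    (∀ (r s : ℕ) (X : FP.Components n r s) (a : Fin r → Fin n) (m : Fin s → Fin n) (ν : Fin n),
      ∀ x ∈ φ.target, ∀ y : FP.Coord n, y ≠ 0 →
        (S.canonical φ).hCov X a m ν x y =
          FP.apCov (FP.apCanonical (S.frozenFrame φ y)) (fun a' m' x' => X a' m' x' y) a m ν x ∧
        (S.dual φ).hCov X a m ν x y =
          FP.apCov (FP.apDual (S.frozenFrame φ y)) (fun a' m' x' => X a' m' x' y) a m ν x) := by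
  obtain ⟨hat, f, hf⟩ := hφ
  have hU := φ.open_target
  have hN : ∀ x ∈ φ.target, ∀ y : FP.Coord n, ∀ α β, S.N φ α β x y = 0 :=
    fun x hx y α β => FP.barthel_eq_zero hU hf α β hx y
  have hΓ : ∀ x ∈ φ.target, ∀ y : FP.Coord n, ∀ α μ ν,
      FP.deltaChristoffel (S.fundamental φ) α μ ν x y = 0 :=
    fun x hx y α μ ν => FP.deltaChristoffel_eq_zero hU hf α μ ν hx y
  have hG : ∀ x ∈ φ.target, ∀ y : FP.Coord n, ∀ α μ ν,
      FP.berwaldG (S.fundamental φ) α μ ν x y = 0 :=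
    fun x hx y α μ ν => FP.berwaldG_eq_zero hU hf α μ ν hx y
  have hM : ∀ x ∈ φ.target, ∀ y : FP.Coord n, y ≠ 0 → ∀ α μ ν, (S.miron φ).F α μ ν x y = 0 := by
    intro x hx y hy α μ ν
    refine FP.christoffel_eq_zero (fun η a b => ?_) α μ ν
    rw [FP.delta_eq_pd (hN x hx y)]
    exact FP.pd_eq_zero_of_eqOn hU (fun x' hx' =>
      (S.finslerMetric_eq_gapMetric hat hx' hy a b).symm.trans
        (FP.finslerMetric_eq_of_position_independent hf a b hx' y)) η hx
  have hC : ∀ x ∈ φ.target, ∀ y : FP.Coord n, y ≠ 0 → ∀ α μ ν,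
      (S.canonical φ).C α μ ν x y = FP.frameC (S.frame φ) α μ ν x y :=
    fun x hx y hy => FP.canonical_C_eq (S.det_frame_ne_zero hat hx hy)
  have hA : ∀ x ∈ φ.target, ∀ y : FP.Coord n, y ≠ 0 → ∀ α μ ν,
      (S.canonical φ).F α μ ν x y = S.A φ α μ ν x y := by
    intro x hx y hy α μ ν
    exact (congrArg (· + S.A φ α μ ν x y) (hM x hx y hy α μ ν)).trans (zero_add _)
  have hAP : ∀ x ∈ φ.target, ∀ y : FP.Coord n, y ≠ 0 → ∀ α μ ν,
      (S.canonical φ).F α μ ν x y = FP.apCanonical (S.frozenFrame φ y) α μ ν x := by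
    intro x hx y hy α μ ν
    refine (FP.canonical_F_eq (S.det_frame_ne_zero hat hx hy) α μ ν).trans ?_
    simp_rw [FP.delta_eq_pd (hN x hx y)]
    rfl
  refine ⟨fun x hx y _ => hN x hx y, fun x hx y hy α μ ν => ⟨hΓ x hx y α μ ν, hM x hx y hy α μ ν⟩,
    fun x hx y _ => ⟨hG x hx y, hN x hx y, fun _ _ _ => rfl⟩,
    fun x hx y _ => ⟨hΓ x hx y, hN x hx y, fun _ _ _ => rfl⟩,
    fun r s X a m ν x hx y _ => ⟨FP.hCov_eq_pd _ (hΓ x hx y) (hN x hx y) X a m ν,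
      FP.hCov_eq_pd _ (hG x hx y) (hN x hx y) X a m ν⟩,
    fun x hx y hy => ⟨hA x hx y hy, hN x hx y, hC x hx y hy⟩,
    fun x hx y hy => ⟨fun α μ ν => hA x hx y hy α ν μ, hN x hx y,
      fun α μ ν => hC x hx y hy α ν μ⟩,
    fun x hx y hy α μ ν => ⟨hAP x hx y hy α μ ν, hAP x hx y hy α ν μ⟩,
    fun r s X a m ν x hx y hy => ⟨?_, ?_⟩⟩
  · exact FP.hCov_eq_apCov _ (hAP x hx y hy) (hN x hx y) X a m ν
  · exact FP.hCov_eq_apCov _ (fun α μ ν => hAP x hx y hy α ν μ) (hN x hx y) X a m ν
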